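/- **Model.** Fix $V_r>0$. A team $R\in\mathcal R_n$ consists of $n\ge 1$ identical point robots in $\mathbb R^2$ that execute the same deterministic protocol in synchronous Look–Compute–Move rounds. In the model $\mathcal{FSTA}$ each robot has an internal light with finitely many colors, initially off, which only the robot itself sees. In a round, every activated robot obtains, in its own local coordinate system (a rotated or reflected one, centred at its position), the set of positions occupied by the robots it sees; from this snapshot and its own color (and its internal identity, if the team has identities) it computes a new color and a destination, and moves to the destination in a straight line. The team $R$ fixes which families of local coordinate systems (one for each robot and round) the adversary may choose, the internal identities if any, and whether movements are rigid or may be stopped by the adversary after at least a fixed distance $\delta>0$. Lengths are measured in a common unit; in particular $V_r$ is known to the robots. Under full visibility ($F.V.$) every robot sees all robots; under limited visibility ($L.V.$) it sees exactly the robots at distance at most $V_r$. Under FSYNCH ($F$) all robots are activated in every round; under SSYNCH ($S$) an adversary activates a non-empty set of robots in each round, every robot infinitely often. The visibility graph of a configuration joins two robots at distance at most $V_r$. A problem for $n$ robots consists of a set of initial configurations with connected visibility graph and a set of admissible evolutions of the configuration; it is solved by $R$ if some protocol has only admissible evolutions from every initial configuration, whatever the adversary does. $\mathrm{Task}(M,X,\mathcal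 V;R)$ is the set of problems that $R$ solves in the model $M$ under the scheduler $X$ with visibility $\mathcal V$. One writes $M^{X}_{\mathcal V}\ge M^{Y}_{\mathcal W}$ if $\mathrm{Task}(M,X,\mathcal V;R)\supseteq \mathrm{Task}(M,Y,\mathcal W;R)$ for all teams $R$ of every size, and $M^{X}_{\mathcal V}> M^{Y}_{\mathcal W}$ if moreover $\mathrm{Task}(M,X,\mathcal V;R)\setminus \mathrm{Task}(M,Y,\mathcal W;R)\ne\emptyset$ for some $R$. **Problem AE (Angle Equalization).** Four robots $r_1,r_2,r_3,r_4$ are placed at $A,B,C,D$ with connected visibility graph. Let $\theta_1$ be the angle at $B$ between $BA$ and the extension of $CB$ beyond $B$, and $\theta_2$ the angle at $C$ between $CD$ and the extension of $BC$ beyond $C$; initially $0<\theta_1<\theta_2<90^\circ$. The set of the four positions determines the roles: no other assignment of $r_1,\dots,r_4$ to these points satisfies the same inequalities. The robots must reach, and then remain at rest in, a configuration in which both angles equal the initial $\theta_2$; $r_2$ and $r_3$ must never move, and there must be no collisions: when all robots moving in a round travel along their segments at constant speed over the round, no two robots are ever at the same point (so a robot cannot pass through another one). **Theorem.** For every $V_r>0$,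 $$\mathcal{FSTA}^{F}_{F.V.}>\mathcal{FSTA}^{F}_{L.V.}\qquad\text{and}\qquad \mathcal{FSTA}^{S}_{F.V.}>\mathcal{FSTA}^{S}_{L.V.},$$ and AE separates the models in both cases: for each $X\in\{F,S\}$ there is a team $R\in\mathcal R_4$ with $AE\in \mathrm{Task}(\mathcal{FSTA},X,F.V.;R)$ and $AE\notin \mathrm{Task}(\mathcal{FSTA},X,L.V.;R)$. -/

import Mathlib

namespace MobileRobots

/-- The Euclidean plane in which the robots move. -/
abbrev Plane : Type := EuclideanSpace ℝ (Fin 2)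

/-- The positions of `n` robots. -/
abbrev Config (n : ℕ) : Type := Fin n → Plane

/-- The orientation of a robot's local coordinate system: a rotation or a reflection of the plane
(no common chirality is built in). Lengths are measured in a common unit, so that the visibility
radius is a length known to every robot. -/
abbrev Frame : Type := Plane ≃ₗᵢ[ℝ] Plane

/-- Full visibility or limited visibility. -/
inductive Visibility where
  | full
  | limited

/-- A robot at `x` sees the point `y`; `V` is the visibility radius. -/
def Visibility.Sees (V : ℝ) : Visibility → Plane → Plane → Prop
  | .full, _, _ => True
  | .limited, x, y => dist x y ≤ V

/-- The visibility graph of a configuration: two robots are adjacent when they are within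
distance `V` of each other. -/
def visibilityGraph (V : ℝ) {n : ℕ} (p : Config n) : SimpleGraph (Fin n) where
  Adj i j := i ≠ j ∧ dist (p i) (p j) ≤ V
  symm := ⟨fun _ _ h => ⟨h.1.symm, by simpa [dist_comm] using h.2⟩⟩
  loopless := ⟨fun _ h => h.1 rfl⟩

/-- Fully synchronous or semi-synchronous activation. -/
inductive Scheduler where
  | fsynch
  | ssynch

/-- `act t` is the set of robots activated in round `t`. FSYNCH: all robots, in every round.
SSYNCH: some robots in every round, and every robot infinitely often. -/
def Scheduler.Allows {n : ℕ} : Scheduler → (ℕ → Set (Fin n)) → Prop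
  | .fsynch, act => ∀ t, act t = Set.univ
  | .ssynch, act => (∀ t, (act t).Nonempty) ∧ ∀ i, ∃ᶠ t in Filter.atTop, i ∈ act t

/-- A team of `n` robots, described by its capabilities.
* `frames`: the families of local coordinate systems (of each robot, in each round) among which the
  adversary chooses. A common coordinate system, systems that are private but constant in time,
  a common chirality, and complete disorientation are all instances.
* `ident`: the internal identity of each robot (constant for anonymous robots).
* `stride`: a robot that is stopped before its destination has travelled at least `stride`;
  the value `⊤` means rigid movements. -/
structure Team (n : ℕ) where
  size_pos : 0 < n
  frames : Set (ℕ → Fin n → Frame)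
  frames_nonempty : frames.Nonempty
  ident : Fin n → ℕ
  stride : ENNReal
  stride_pos : 0 < stride

/-- The protocol of finite-state robots. Each robot has an internal light with finitely many
colors, initially `off`. From its identity, the color of its own light and the snapshot
it computes the new color and a destination, in local coordinates. -/
structure Protocol where
  Color : Type
  finite_color : Finite Color
  off : Color
  compute : ℕ → Color → Set Plane → Color × Plane

/-- The result of the Look operation of robot `i`: the set of the positions occupied by the robots
that it sees, in its local coordinate system (in which it is itself at the origin). The lights of
the other robots are not seen. -/
def snapshot (V : ℝ) (vis : Visibility) {n : ℕ} (p : Config n) (φ : Frame) (i : Fin n) :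
    Set Plane :=
  {x | ∃ j, vis.Sees V (p i) (p j) ∧ x = φ (p j - p i)}

/-- A move from `x` towards the destination `y` along a straight line may end at `z`. -/
def MoveEndsAt (stride : ENNReal) (x y z : Plane) : Prop :=
  z ∈ segment ℝ x y ∧ min stride (edist x y) ≤ edist x z

/-- `pos t` and `light t` are the positions and colors at the beginning of round `t` in an execution
of the protocol `A` by the team `R` from the configuration `p₀`, for the activations `act` and the
local coordinate systems `φ`. -/
structure IsExecution (V : ℝ) (vis : Visibility) {n : ℕ} (R : Team n) (A : Protocol)
    (act : ℕ → Set (Fin n)) (φ : ℕ → Fin n → Frame) (p₀ : Config n)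
    (pos : ℕ → Config n) (light : ℕ → Fin n → A.Color) : Prop where
  pos_zero : pos 0 = p₀
  light_zero : ∀ i, light 0 i = A.off
  idle : ∀ t i, i ∉ act t → pos (t + 1) i = pos t i ∧ light (t + 1) i = light t i
  active_light : ∀ t i, i ∈ act t →
    light (t + 1) i =
      (A.compute (R.ident i) (light t i) (snapshot V vis (pos t) (φ t i) i)).1
  active_move : ∀ t i, i ∈ act t →
    MoveEndsAt R.stride (pos t i)
      (pos t i + (φ t i).symm
        (A.compute (R.ident i) (light t i) (snapshot V vis (pos t) (φ t i) i)).2)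
      (pos (t + 1) i)

/-- A problem for `n` robots: the initial configurations, whose visibility graphs must be connected,
and the admissible evolutions of the configuration over the rounds. -/
structure Problem (V : ℝ) (n : ℕ) where
  initial : Set (Config n)
  connected : ∀ p ∈ initial, (visibilityGraph V p).Connected
  admissible : Set (ℕ → Config n)

/-- The protocol `A` solves `P` with team `R`: from every initial configuration, whatever the
adversary does, the evolution is admissible. -/
def Solves (V : ℝ) (S : Scheduler) (vis : Visibility) {n : ℕ} (R : Team n) (A : Protocol)
    (P : Problem V n) : Prop :=
  ∀ p₀ ∈ P.initial, ∀ act, S.Allows act → ∀ φ ∈ R.frames, ∀ pos light,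
    IsExecution V vis R A act φ p₀ pos light → pos ∈ P.admissible

/-- `Task(FSTA, S, vis; R)`: the problems that finite-state robots solve with the team `R`. -/
def Task (V : ℝ) (S : Scheduler) (vis : Visibility) {n : ℕ} (R : Team n) : Set (Problem V n) :=
  {P | ∃ A : Protocol, Solves V S vis R A P}

/-- `FSTA` under `S₁` with visibility `v₁` is computationally not less powerful than under `S₂`
with visibility `v₂`. -/
def NotLessPowerful (V : ℝ) (S₁ : Scheduler) (v₁ : Visibility) (S₂ : Scheduler)
    (v₂ : Visibility) : Prop :=
  ∀ (n : ℕ) (R : Team n), Task V S₂ v₂ R ⊆ Task V S₁ v₁ R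

/-- `FSTA` under `S₁` with visibility `v₁` is computationally more powerful than under `S₂`
with visibility `v₂`. -/
def MorePowerful (V : ℝ) (S₁ : Scheduler) (v₁ : Visibility) (S₂ : Scheduler)
    (v₂ : Visibility) : Prop :=
  NotLessPowerful V S₁ v₁ S₂ v₂ ∧
    ∃ (n : ℕ) (R : Team n), (Task V S₁ v₁ R \ Task V S₂ v₂ R).Nonempty

/-! ### Angle equalization

The robots `r₁, r₂, r₃, r₄` have the indices `0, 1, 2, 3`. -/

/-- The angle at `r₂` between the segment to `r₁` and the extension of the segment from `r₃`
beyond `r₂`. -/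
noncomputable def angleB (p : Config 4) : ℝ :=
  InnerProductGeometry.angle (p 0 - p 1) (p 1 - p 2)

/-- The angle at `r₃` between the segment to `r₄` and the extension of the segment from `r₂`
beyond `r₃`. -/
noncomputable def angleC (p : Config 4) : ℝ :=
  InnerProductGeometry.angle (p 3 - p 2) (p 2 - p 1)

/-- The shape of the initial configuration: `0 < θ₁ < θ₂ < 90°`. -/
def IsConfigI (p : Config 4) : Prop :=
  0 < angleB p ∧ angleB p < angleC p ∧ angleC p < Real.pi / 2

/-- The roles of the four robots can be recognized from the occupied positions alone. -/
def RolesDetermined (p : Config 4) : Prop :=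
  ∀ σ : Equiv.Perm (Fin 4), IsConfigI (p ∘ σ) → σ = 1

/-- During each round every robot travels on a straight segment, at constant speed;
no two robots are ever at the same point. -/
def CollisionFree {n : ℕ} (pos : ℕ → Config n) : Prop :=
  ∀ t, ∀ s ∈ Set.Icc (0 : ℝ) 1,
    Function.Injective fun i => AffineMap.lineMap (pos t i) (pos (t + 1) i) s

/-- The problem Angle Equalization: without collisions, and with `r₂` and `r₃` fixed, the robots
come to rest in a configuration in which both angles are equal to the initial `θ₂`. -/
def AE (V : ℝ) : Problem V 4 where
  initial := {p | IsConfigI p ∧ RolesDetermined p ∧ (visibilityGraph V p).Connected}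
  connected := fun _ h => h.2.2
  admissible := {pos |
    (∀ t, pos t 1 = pos 0 1 ∧ pos t 2 = pos 0 2) ∧
    CollisionFree pos ∧
    ∃ T, (∀ t ≥ T, pos t = pos T) ∧
      angleB (pos T) = angleC (pos 0) ∧ angleC (pos T) = angleC (pos 0)}

end MobileRobots

namespace MobileRobots

/-! ### Limited visibility is simulated under full visibility -/

/-! Full visibility is at least as strong because a robot that knows `V` can discard the points
farther away than `V` and run the limited-visibility protocol unchanged.

For AE under full visibility, the positions reveal the roles, so `r₁` alone moves, to B + C - D. The
result is symmetric under a point reflection, so no roles can be recognized in it and everybody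
rests (`AE_mem_task_full`).

Under limited visibility, take chains whose consecutive robots are at distance `V`, with arms `a`
and `d` pointing outwards. Each end robot sees at most its neighbor, so by choosing frames the
adversary can multiply each arm by `g` or by its conjugate, independently, where `g` depends only on
the color and the arm length (`exists_multiplier`). If `g` is neither real nor imaginary, two chains
with different θ₂ can be driven into indistinguishable states, which is fatal because the final
angle must reveal θ₂ (`Uniform.multiplier`). Hence `g ^ 2` is real, and the squares of both arms are
always the same real multiple `m` of the initial squares. Absence of collisions makes a real `g`
positive; for an imaginary `g`, one of `g` and its conjugate keeps an arm in its half plane. So the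
invariant persists forever (`Uniform.next`), and it keeps the two angles different
(`IsSimilar.angle_ne`). -/

theorem snapshot_limited (V : ℝ) {n : ℕ} (p : Config n) (φ : Frame) (i : Fin n) :
    {x ∈ snapshot V .full p φ i | ‖x‖ ≤ V} = snapshot V .limited p φ i := by
  ext x
  constructor
  · rintro ⟨⟨j, -, rfl⟩, h⟩
    refine ⟨j, ?_, rfl⟩
    rw [LinearIsometryEquiv.norm_map, ← dist_eq_norm] at h
    simpa [Visibility.Sees, dist_comm] using h
  · rintro ⟨j, h, rfl⟩
    refine ⟨⟨j, trivial, rfl⟩, ?_⟩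
    rw [LinearIsometryEquiv.norm_map, ← dist_eq_norm, dist_comm]
    exact h

theorem notLessPowerful_full_limited (V : ℝ) (S : Scheduler) :
    NotLessPowerful V S .full S .limited := by
  rintro n R P ⟨A, hA⟩
  refine ⟨⟨A.Color, A.finite_color, A.off, fun k c s => A.compute k c {x ∈ s | ‖x‖ ≤ V}⟩, ?_⟩
  intro p₀ hp₀ act hact φ hφ pos light h
  refine hA p₀ hp₀ act hact φ hφ pos light ⟨h.pos_zero, h.light_zero, h.idle, ?_, ?_⟩
  · intro t i hi
    simpa only [snapshot_limited] using h.active_light t i hi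
  · intro t i hi
    simpa only [snapshot_limited] using h.active_move t i hi

/-! ### The team -/

/-- Anonymous, completely disoriented robots with rigid movements. -/
noncomputable def anonymousTeam (n : ℕ) (hn : 0 < n) : Team n where
  size_pos := hn
  frames := Set.univ
  frames_nonempty := Set.univ_nonempty
  ident := fun _ => 0
  stride := ⊤
  stride_pos := by simp

theorem moveEndsAt_top {x y z : Plane} : MoveEndsAt ⊤ x y z ↔ z = y := by
  constructor
  · rintro ⟨hz, h⟩
    rw [top_inf_eq, edist_dist, edist_dist, ENNReal.ofReal_le_ofReal_iff dist_nonneg] at h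
    have h1 := dist_add_dist_of_mem_segment hz
    have : dist z y ≤ 0 := by linarith
    exact dist_le_zero.1 this
  · rintro rfl
    exact ⟨right_mem_segment ℝ x z, by simp⟩

theorem Scheduler.Allows.exists_mem {n : ℕ} {S : Scheduler} {act : ℕ → Set (Fin n)}
    (h : S.Allows act) (i : Fin n) : ∃ t, i ∈ act t := by
  cases S with
  | fsynch => exact ⟨0, by rw [h 0]; trivial⟩
  | ssynch => exact (h.2 i).exists

theorem Scheduler.allows_univ {n : ℕ} (hn : 0 < n) (S : Scheduler) :
    S.Allows (fun _ => (Set.univ : Set (Fin n))) := by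
  cases S with
  | fsynch => exact fun _ => rfl
  | ssynch =>
    exact ⟨fun _ => ⟨⟨0, hn⟩, trivial⟩, fun _ => Filter.Frequently.of_forall fun _ => trivial⟩

/-! ### Shapes of configurations -/

/-- Covers changes of frame, translations and point reflections at once. -/
theorem isConfigI_congr {p q : Config 4} (h : ∀ i j k l,
    inner ℝ (p i - p j) (p k - p l) = inner ℝ (q i - q j) (q k - q l)) :
    IsConfigI p ↔ IsConfigI q := by
  have hn : ∀ i j, ‖p i - p j‖ = ‖q i - q j‖ := fun i j => by
    rw [norm_eq_sqrt_real_inner, norm_eq_sqrt_real_inner, h]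
  simp only [IsConfigI, angleB, angleC, InnerProductGeometry.angle, h, hn]

theorem inner_pos_of_angle_lt {x y : Plane}
    (h : InnerProductGeometry.angle x y < Real.pi / 2) : 0 < inner ℝ x y := by
  rw [← InnerProductGeometry.cos_angle_mul_norm_mul_norm x y]
  have h0 : x ≠ 0 := by rintro rfl; simp at h
  have h1 : y ≠ 0 := by rintro rfl; simp at h
  have h2 := Real.cos_pos_of_mem_Ioo (x := InnerProductGeometry.angle x y)
    ⟨by linarith [InnerProductGeometry.angle_nonneg x y, Real.pi_pos], h⟩
  positivity

theorem IsConfigI.inner_pos {p : Config 4} (h : IsConfigI p) :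
    0 < inner ℝ (p 0 - p 1) (p 1 - p 2) ∧ 0 < inner ℝ (p 3 - p 2) (p 2 - p 1) :=
  ⟨inner_pos_of_angle_lt (h.2.1.trans h.2.2), inner_pos_of_angle_lt h.2.2⟩

/-- Swapping two coinciding robots would be a nontrivial relabeling with the same shape. -/
theorem RolesDetermined.injective {p : Config 4} (h : RolesDetermined p) (hp : IsConfigI p) :
    Function.Injective p := by
  intro i j hij
  by_contra hne
  have h1 : p ∘ Equiv.swap i j = p := by
    funext k
    simp only [Function.comp_apply]
    rcases eq_or_ne k i with rfl | hi
    · rw [Equiv.swap_apply_left, hij]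
    · rcases eq_or_ne k j with rfl | hj
      · rw [Equiv.swap_apply_right, hij]
      · rw [Equiv.swap_apply_of_ne_of_ne hi hj]
  have h2 := h (Equiv.swap i j) (by rwa [h1])
  exact hne (Equiv.swap_eq_one_iff.1 h2)

theorem exists_perm_of_range_eq {α : Type*} {n : ℕ} {p q : Fin n → α} (hp : Function.Injective p)
    (h : Set.range q = Set.range p) : ∃ σ : Equiv.Perm (Fin n), q = p ∘ σ := by
  have h1 : ∀ i, ∃ j, p j = q i := fun i => by
    have : q i ∈ Set.range p := h ▸ Set.mem_range_self i
    exact this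
  choose σ hσ using h1
  have h2 : Function.Surjective σ := by
    intro j
    have : p j ∈ Set.range q := h ▸ Set.mem_range_self j
    obtain ⟨i, hi⟩ := this
    exact ⟨i, hp (by rw [hσ, hi])⟩
  exact ⟨Equiv.ofBijective σ (Finite.surjective_iff_bijective.1 h2), by funext i; simp [hσ]⟩

theorem RolesDetermined.eq_of_range_eq {p q : Config 4} (h : RolesDetermined p) (hp : IsConfigI p)
    (hq : IsConfigI q) (hr : Set.range q = Set.range p) : q = p := by
  obtain ⟨σ, rfl⟩ := exists_perm_of_range_eq (h.injective hp) hr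
  rw [h σ hq]
  rfl

/-- A configuration as seen in a local coordinate system. -/
noncomputable def localView {n : ℕ} (p : Config n) (φ : Frame) (i : Fin n) : Config n := fun j => φ (p j - p i)

theorem localView_sub {n : ℕ} (p : Config n) (φ : Frame) (i j k : Fin n) :
    localView p φ i j - localView p φ i k = φ (p j - p k) := by
  simp [localView]

theorem snapshot_full (V : ℝ) {n : ℕ} (p : Config n) (φ : Frame) (i : Fin n) :
    snapshot V .full p φ i = Set.range (localView p φ i) := by
  ext x
  simp [snapshot, Visibility.Sees, localView, eq_comm]

theorem isConfigI_localView (p : Config 4) (φ : Frame) (i : Fin 4) (σ : Equiv.Perm (Fin 4)) :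
    IsConfigI (localView p φ i ∘ σ) ↔ IsConfigI (p ∘ σ) := by
  refine isConfigI_congr fun a b c d => ?_
  simp only [Function.comp_apply, localView_sub, LinearIsometryEquiv.inner_map_map]

theorem rolesDetermined_localView {p : Config 4} (h : RolesDetermined p) (φ : Frame) (i : Fin 4) :
    RolesDetermined (localView p φ i) :=
  fun σ hσ => h σ ((isConfigI_localView p φ i σ).1 hσ)

/-- A configuration whose robots can be reversed by a point reflection has no recognizable
roles. -/
theorem not_rolesDetermined_of_reversal {p q : Config 4} (hp : ∀ i, p (Fin.rev i) = p 1 + p 2 - p i)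
    (hinj : Function.Injective p) (hr : Set.range q = Set.range p) (hq : IsConfigI q) :
    ¬ RolesDetermined q := by
  intro hd
  obtain ⟨σ, rfl⟩ := exists_perm_of_range_eq hinj hr
  -- The conjugated reversal acts on `p ∘ σ` as the point reflection, which preserves all inner
  -- products of differences.
  have h1 : IsConfigI ((p ∘ σ) ∘ (σ⁻¹ * Fin.revPerm * σ : Equiv.Perm (Fin 4))) := by
    refine (isConfigI_congr fun a b c d => ?_).1 hq
    have e : ∀ x, σ ((σ⁻¹ * Fin.revPerm * σ : Equiv.Perm (Fin 4)) x) = Fin.rev (σ x) := fun x => by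
      simp [Equiv.Perm.mul_apply]
    simp only [Function.comp_apply, e, hp]
    rw [sub_sub_sub_cancel_left, sub_sub_sub_cancel_left, ← neg_sub (p (σ a)), ← neg_sub (p (σ c)),
      inner_neg_neg]
  have h2 := hd _ h1
  have h3 : (Fin.revPerm : Equiv.Perm (Fin 4)) = 1 := by
    have : (Fin.revPerm : Equiv.Perm (Fin 4)) = σ * (σ⁻¹ * Fin.revPerm * σ) * σ⁻¹ := by group
    rw [this, h2]
    group
  exact absurd (DFunLike.congr_fun h3 0) (by decide)

/-! ### Angle equalization under full visibility -/

open Classical in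
/-- The protocol for full visibility: the robot that recognizes itself as `r₁` completes the
parallelogram; the other robots stay where they are. -/
noncomputable def parallelogramProtocol : Protocol where
  Color := Unit
  finite_color := inferInstance
  off := ()
  compute := fun _ _ s =>
    ((), if h : ∃ p : Config 4, Set.range p = s ∧ IsConfigI p ∧ RolesDetermined p ∧ p 0 = 0 then
      h.choose 1 + h.choose 2 - h.choose 3 else 0)

theorem parallelogramProtocol_first {p : Config 4} (hp : IsConfigI p) (hd : RolesDetermined p)
    (φ : Frame) (k : ℕ) (c : parallelogramProtocol.Color) :
    p 0 + φ.symm (parallelogramProtocol.compute k c (Set.range (localView p φ 0))).2 =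
      p 1 + p 2 - p 3 := by
  have hp' : IsConfigI (localView p φ 0) := (isConfigI_localView p φ 0 1).2 hp
  have hd' := rolesDetermined_localView hd φ 0
  have hex : ∃ q : Config 4, Set.range q = Set.range (localView p φ 0) ∧ IsConfigI q ∧
      RolesDetermined q ∧ q 0 = 0 := ⟨_, rfl, hp', hd', by simp [localView]⟩
  have hq : hex.choose = localView p φ 0 :=
    hd'.eq_of_range_eq hp' hex.choose_spec.2.1 hex.choose_spec.1
  simp only [parallelogramProtocol, dif_pos hex, hq, localView]
  simp only [map_add, map_sub, LinearIsometryEquiv.symm_apply_apply]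
  abel

theorem parallelogramProtocol_other {p : Config 4} (hp : IsConfigI p) (hd : RolesDetermined p)
    (φ : Frame) (k : ℕ) (c : parallelogramProtocol.Color) {i : Fin 4} (hi : i ≠ 0) :
    (parallelogramProtocol.compute k c (Set.range (localView p φ i))).2 = 0 := by
  have hp' : IsConfigI (localView p φ i) := (isConfigI_localView p φ i 1).2 hp
  have hd' := rolesDetermined_localView hd φ i
  refine dif_neg ?_
  rintro ⟨q, hr, hq, -, h0⟩
  rw [hd'.eq_of_range_eq hp' hq hr] at h0
  have h1 : p 0 - p i = 0 := (φ.map_eq_zero_iff).1 h0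
  exact hi (hd.injective hp (sub_eq_zero.1 h1)).symm

/-- Any labeling found by the protocol could be carried back to global coordinates, where the
symmetry of `p` rules out recognizable roles. -/
theorem parallelogramProtocol_rest {p : Config 4} (hp : ∀ i, p (Fin.rev i) = p 1 + p 2 - p i)
    (hinj : Function.Injective p) (φ : Frame) (k : ℕ) (c : parallelogramProtocol.Color) (i : Fin 4) :
    (parallelogramProtocol.compute k c (Set.range (localView p φ i))).2 = 0 := by
  refine dif_neg ?_
  rintro ⟨q, hr, hq, hd, -⟩
  have hs : Set.range (fun j => p i + φ.symm (q j)) = Set.range p := by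
    have h1 : (fun j => p i + φ.symm (q j)) = (fun x => p i + φ.symm x) ∘ q := rfl
    rw [h1, Set.range_comp, hr, ← Set.range_comp]
    congr 1
    funext j
    simp [localView]
  have key : ∀ σ : Equiv.Perm (Fin 4),
      IsConfigI ((fun j => p i + φ.symm (q j)) ∘ σ) ↔ IsConfigI (q ∘ σ) := fun σ =>
    isConfigI_congr fun a b c d => by
      simp only [Function.comp_apply, add_sub_add_left_eq_sub, ← map_sub,
        LinearIsometryEquiv.inner_map_map]
  exact not_rolesDetermined_of_reversal hp hinj hs ((key 1).2 hq)
    fun σ hσ => hd σ ((key σ).1 hσ)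

/-- The configuration in which `r₁` has completed the parallelogram. -/
noncomputable def completed (p : Config 4) : Config 4 :=
  Function.update p 0 (p 1 + p 2 - p 3)

theorem completed_rev (p : Config 4) (i : Fin 4) :
    completed p (Fin.rev i) = completed p 1 + completed p 2 - completed p i := by
  have h1 : completed p 1 = p 1 := rfl
  have h2 : completed p 2 = p 2 := rfl
  have h3 : completed p 3 = p 3 := rfl
  have h0 : completed p 0 = p 1 + p 2 - p 3 := rfl
  fin_cases i
  · change completed p 3 = completed p 1 + completed p 2 - completed p 0
    rw [h0, h1, h2, h3]; abel
  · change completed p 2 = completed p 1 + completed p 2 - completed p 1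
    abel
  · change completed p 1 = completed p 1 + completed p 2 - completed p 2
    abel
  · change completed p 0 = completed p 1 + completed p 2 - completed p 3
    rw [h0, h1, h2, h3]

/-- On the way to its destination, `r₁` stays on its side of the line through `r₂` that is
orthogonal to the line `r₂ r₃`, and hence does not meet the other robots. -/
theorem injective_lineMap_completed {p : Config 4} (hp : IsConfigI p)
    (hinj : Function.Injective p) {s : ℝ} (hs : s ∈ Set.Icc (0 : ℝ) 1) :
    Function.Injective fun i => AffineMap.lineMap (p i) (completed p i) s := by
  obtain ⟨hB, hC⟩ := hp.inner_pos
  set x : Plane := AffineMap.lineMap (p 0) (completed p 0) s with hx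
  have h0 : completed p 0 = p 1 + p 2 - p 3 := rfl
  have hxB : 0 < inner ℝ (x - p 1) (p 1 - p 2) := by
    have e : x - p 1 = (1 - s) • (p 0 - p 1) + s • (p 2 - p 3) := by
      rw [hx, h0, AffineMap.lineMap_apply_module]; module
    have e2 : inner ℝ (p 2 - p 3) (p 1 - p 2) = inner ℝ (p 3 - p 2) (p 2 - p 1) := by
      rw [← neg_sub (p 3), ← neg_sub (p 2) (p 1), inner_neg_neg]
    rw [e, inner_add_left, real_inner_smul_left, real_inner_smul_left, e2]
    rcases eq_or_lt_of_le hs.1 with h | h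
    · rw [← h]; simpa using hB
    · have := mul_pos h hC
      have := mul_nonneg (sub_nonneg.2 hs.2) hB.le
      linarith
  have hne : ∀ j : Fin 4, j ≠ 0 → x ≠ p j := by
    intro j hj e
    rw [e] at hxB
    fin_cases j
    · exact hj rfl
    · simp at hxB
    · change 0 < inner ℝ (p 2 - p 1) (p 1 - p 2) at hxB
      rw [← neg_sub (p 1) (p 2), inner_neg_left, real_inner_self_eq_norm_sq] at hxB
      nlinarith [sq_nonneg ‖p 1 - p 2‖]
    · change 0 < inner ℝ (p 3 - p 1) (p 1 - p 2) at hxB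
      have e3 : p 3 - p 1 = (p 3 - p 2) - (p 1 - p 2) := by abel
      rw [e3, inner_sub_left, real_inner_self_eq_norm_sq] at hxB
      rw [← neg_sub (p 1) (p 2), inner_neg_right] at hC
      nlinarith [sq_nonneg ‖p 1 - p 2‖]
  have hj : ∀ j : Fin 4, j ≠ 0 → AffineMap.lineMap (p j) (completed p j) s = p j := fun j h => by
    have : completed p j = p j := Function.update_of_ne h _ _
    rw [this, AffineMap.lineMap_same_apply]
  intro i j hij
  dsimp only at hij
  by_cases hi0 : i = 0
  · by_cases hj0 : j = 0
    · rw [hi0, hj0]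
    · rw [hj j hj0, hi0] at hij
      exact absurd hij (hne j hj0)
  · by_cases hj0 : j = 0
    · rw [hj i hi0, hj0] at hij
      exact absurd hij.symm (hne i hi0)
    · rw [hj i hi0, hj j hj0] at hij
      exact hinj hij

theorem completed_injective {p : Config 4} (hp : IsConfigI p) (hinj : Function.Injective p) :
    Function.Injective (completed p) := by
  simpa using injective_lineMap_completed hp hinj (s := 1) (by simp)

theorem angleB_completed (p : Config 4) : angleB (completed p) = angleC p := by
  have h1 : completed p 1 = p 1 := rfl
  have h2 : completed p 2 = p 2 := rfl
  have h0 : completed p 0 = p 1 + p 2 - p 3 := rfl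
  rw [angleB, angleC, h0, h1, h2, ← InnerProductGeometry.angle_neg_neg]
  congr 1 <;> abel

theorem AE_mem_task_full (V : ℝ) (S : Scheduler) :
    AE V ∈ Task V S .full (anonymousTeam 4 (by norm_num)) := by
  refine ⟨parallelogramProtocol, ?_⟩
  rintro p ⟨hp, hd, -⟩ act hact φ - pos light h
  have hinj := hd.injective hp
  have move : ∀ t i, i ∈ act t → pos (t + 1) i = pos t i + (φ t i).symm
      (parallelogramProtocol.compute 0 (light t i) (Set.range (localView (pos t) (φ t i) i))).2 := by
    intro t i hi
    have := moveEndsAt_top.1 (h.active_move t i hi)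
    rwa [snapshot_full] at this
  have step_first : ∀ t, pos t = p → (0 ∈ act t → pos (t + 1) = completed p) ∧
      (0 ∉ act t → pos (t + 1) = p) := by
    intro t ht
    have others : ∀ i, i ≠ 0 → pos (t + 1) i = p i := by
      intro i hi
      by_cases ha : i ∈ act t
      · rw [move t i ha, ht, parallelogramProtocol_other hp hd _ _ _ hi, map_zero, add_zero]
      · rw [(h.idle t i ha).1, ht]
    constructor
    · intro ha
      funext i
      by_cases hi : i = 0
      · rw [hi, move t 0 ha, ht, parallelogramProtocol_first hp hd]
        rfl
      · rw [others i hi]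
        exact (Function.update_of_ne hi _ _).symm
    · intro ha
      funext i
      by_cases hi : i = 0
      · rw [hi, (h.idle t 0 ha).1, ht]
      · exact others i hi
  have step_second : ∀ t, pos t = completed p → pos (t + 1) = completed p := by
    intro t ht
    funext i
    by_cases ha : i ∈ act t
    · rw [move t i ha, ht, parallelogramProtocol_rest (completed_rev p)
        (completed_injective hp hinj), map_zero, add_zero]
    · rw [(h.idle t i ha).1, ht]
  -- Under SSYNCH nothing happens until `r₁` is activated for the first time.
  have two : ∀ t, pos t = p ∨ pos t = completed p := by
    intro t
    induction t with
    | zero => exact Or.inl h.pos_zero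
    | succ t ih =>
      rcases ih with ht | ht
      · by_cases ha : 0 ∈ act t
        · exact Or.inr ((step_first t ht).1 ha)
        · exact Or.inl ((step_first t ht).2 ha)
      · exact Or.inr (step_second t ht)
  obtain ⟨t₀, ht₀⟩ := hact.exists_mem 0
  have hT : pos (t₀ + 1) = completed p := by
    rcases two t₀ with ht | ht
    · exact (step_first t₀ ht).1 ht₀
    · exact step_second t₀ ht
  have hT' : ∀ t ≥ t₀ + 1, pos t = completed p := by
    intro t ht
    induction t, ht using Nat.le_induction with
    | base => exact hT
    | succ t _ ih => exact step_second t ih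
  refine ⟨fun t => ?_, fun t s hs => ?_, t₀ + 1, fun t ht => by rw [hT' t ht, hT], ?_, ?_⟩
  · rw [h.pos_zero]
    rcases two t with ht | ht <;> rw [ht] <;> exact ⟨rfl, rfl⟩
  · rcases two t with ht | ht
    · by_cases ha : 0 ∈ act t
      · rw [ht, (step_first t ht).1 ha]
        exact injective_lineMap_completed hp hinj hs
      · rw [ht, (step_first t ht).2 ha]
        simpa using hinj
    · rw [ht, step_second t ht]
      simpa using completed_injective hp hinj
  · rw [hT, h.pos_zero, angleB_completed]
  · rw [hT, h.pos_zero]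
    rfl

open ComplexConjugate

/-! ### Chains of four robots in complex coordinates -/

/-- The plane in complex coordinates. -/
noncomputable def ofComplex : ℂ ≃ₗᵢ[ℝ] Plane := Complex.orthonormalBasisOneI.repr

/-- The configuration in which `r₂` and `r₃` are at `0` and `V`, and `a` and `d` are the positions
of `r₁` and `r₄` relative to `r₂` and `r₃`. -/
noncomputable def chain (V : ℝ) (a d : ℂ) : Config 4 :=
  fun i => ofComplex (![a, 0, (V : ℂ), (V : ℂ) + d] i)

theorem chain_zero (V : ℝ) (a d : ℂ) : chain V a d 0 = ofComplex a := rfl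
theorem chain_one (V : ℝ) (a d : ℂ) : chain V a d 1 = 0 := map_zero ofComplex
theorem chain_two (V : ℝ) (a d : ℂ) : chain V a d 2 = ofComplex V := rfl
theorem chain_three (V : ℝ) (a d : ℂ) : chain V a d 3 = ofComplex (V + d) := rfl

theorem angleB_chain {V : ℝ} (hV : 0 < V) (a d : ℂ) :
    angleB (chain V a d) = Real.arccos (-a.re / ‖a‖) := by
  rw [angleB, chain_zero, chain_one, chain_two, sub_zero, zero_sub, ← map_neg,
    InnerProductGeometry.angle, LinearIsometryEquiv.inner_map_map, LinearIsometryEquiv.norm_map,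
    LinearIsometryEquiv.norm_map, Complex.inner, norm_neg, Complex.norm_real, Real.norm_eq_abs,
    abs_of_pos hV]
  congr 1
  simp
  field_simp

theorem angleC_chain {V : ℝ} (hV : 0 < V) (a d : ℂ) :
    angleC (chain V a d) = Real.arccos (d.re / ‖d‖) := by
  rw [angleC, chain_three, chain_one, chain_two, sub_zero, ← map_sub, add_sub_cancel_left,
    InnerProductGeometry.angle, LinearIsometryEquiv.inner_map_map, LinearIsometryEquiv.norm_map,
    LinearIsometryEquiv.norm_map, Complex.inner, Complex.norm_real, Real.norm_eq_abs,
    abs_of_pos hV]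
  congr 1
  simp
  field_simp

/-- Parameters of the initial chains: consecutive robots are at distance `V`. -/
structure IsInitialChain (V : ℝ) (a d : ℂ) : Prop where
  norm_left : ‖a‖ = V
  norm_right : ‖d‖ = V
  re_pos : 0 < d.re
  re_lt : d.re < -a.re
  im_ne : a.im ≠ 0

theorem neg_re_lt_norm {a : ℂ} (h : a.im ≠ 0) : -a.re < ‖a‖ := by
  have := Complex.abs_re_lt_norm.2 h
  exact (neg_le_abs _).trans_lt this

/-- Both arms have length `V`, so the angles are the arccosines of `-a.re / V` and `d.re / V`:
`im_ne` gives θ₁ > 0, `re_lt` gives θ₁ < θ₂ and `re_pos` gives θ₂ < 90°. -/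
theorem IsInitialChain.isConfigI {V : ℝ} (hV : 0 < V) {a d : ℂ} (h : IsInitialChain V a d) :
    IsConfigI (chain V a d) := by
  have h1 := neg_re_lt_norm h.im_ne
  rw [IsConfigI, angleB_chain hV, angleC_chain hV, h.norm_left, h.norm_right]
  rw [h.norm_left] at h1
  have h2 := h.re_pos
  have h3 := h.re_lt
  have h4 : d.re / V < -a.re / V := by gcongr
  have h5 : -a.re / V < 1 := by rwa [div_lt_one hV]
  have h6 : 0 < d.re / V := by positivity
  refine ⟨Real.arccos_pos.2 h5, Real.arccos_lt_arccos (by linarith) h4 h5.le,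
    Real.arccos_lt_pi_div_two.2 h6⟩

/-- Turns the sign of an inner product into a linear inequality between squared distances, the form
used by `chain_order`. -/
theorem inner_sub_sub_eq (x y z : Plane) :
    inner ℝ (x - y) (y - z) = (dist x z ^ 2 - dist x y ^ 2 - dist y z ^ 2) / 2 := by
  have h := norm_add_sq_real (x - y) (y - z)
  rw [sub_add_sub_cancel] at h
  rw [dist_eq_norm, dist_eq_norm, dist_eq_norm]
  linarith

theorem dist_ofComplex_sq (z w : ℂ) :
    dist (ofComplex z) (ofComplex w) ^ 2 = (z.re - w.re) ^ 2 + (z.im - w.im) ^ 2 := by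
  rw [LinearIsometryEquiv.dist_map, dist_eq_norm, Complex.sq_norm, Complex.normSq_apply]
  simp; ring

/-- Two orders on four points with the distances of a chain for which both inner angles are
obtuse. -/
theorem chain_order {D : Fin 4 → Fin 4 → ℝ} {u m n l : ℝ} (hu : 0 < u) (hm : u < m) (hn : u < n)
    (hml : m < l + u) (hnl : n < l + u)
    (symm : ∀ i j, D i j = D j i) (h01 : D 0 1 = u) (h12 : D 1 2 = u) (h23 : D 2 3 = u)
    (h02 : D 0 2 = m) (h13 : D 1 3 = n) (h03 : D 0 3 = l)
    (i : Fin 4 → Fin 4) (hi : Function.Injective i)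
    (h1 : D (i 0) (i 1) + D (i 1) (i 2) < D (i 0) (i 2))
    (h2 : D (i 1) (i 2) + D (i 2) (i 3) < D (i 1) (i 3)) :
    (i 0 = 0 ∧ i 1 = 1 ∧ i 2 = 2 ∧ i 3 = 3) ∨ (i 0 = 3 ∧ i 1 = 2 ∧ i 2 = 1 ∧ i 3 = 0) := by
  have h10 : D 1 0 = u := by rw [symm, h01]
  have h21 : D 2 1 = u := by rw [symm, h12]
  have h32 : D 3 2 = u := by rw [symm, h23]
  have h20 : D 2 0 = m := by rw [symm, h02]
  have h31 : D 3 1 = n := by rw [symm, h13]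
  have h30 : D 3 0 = l := by rw [symm, h03]
  have n01 : i 0 ≠ i 1 := hi.ne (by decide)
  have n02 : i 0 ≠ i 2 := hi.ne (by decide)
  have n03 : i 0 ≠ i 3 := hi.ne (by decide)
  have n12 : i 1 ≠ i 2 := hi.ne (by decide)
  have n13 : i 1 ≠ i 3 := hi.ne (by decide)
  have n23 : i 2 ≠ i 3 := hi.ne (by decide)
  generalize i 0 = a at *
  generalize i 1 = b at *
  generalize i 2 = c at *
  generalize i 3 = d at *
  clear hi i symm
  fin_cases a <;> fin_cases b <;> first | exact absurd rfl n01 | skip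
  all_goals fin_cases c <;> first | exact absurd rfl n02 | exact absurd rfl n12 | skip
  all_goals fin_cases d <;>
    first | exact absurd rfl n03 | exact absurd rfl n13 | exact absurd rfl n23 | skip
  all_goals
    simp only [Fin.zero_eta, Fin.mk_one, Fin.reduceFinMk, h01, h10, h12, h21, h23, h32, h02, h20,
      h13, h31, h03, h30] at h1 h2
    first
    | (exfalso; linarith)
    | simp

/-- Obtuse inner angles leave only the identity and the reversal; the reversal exchanges θ₁ and θ₂
and so violates θ₁ < θ₂. -/
theorem IsInitialChain.rolesDetermined {V : ℝ} (hV : 0 < V) {a d : ℂ} (h : IsInitialChain V a d) :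
    RolesDetermined (chain V a d) := by
  intro σ hσ
  have hp := h.isConfigI hV
  obtain ⟨i1, i2⟩ := hσ.inner_pos
  simp only [Function.comp_apply] at i1 i2
  set p := chain V a d with hpdef
  rw [inner_sub_sub_eq] at i1 i2
  have ha : a.re ^ 2 + a.im ^ 2 = V ^ 2 := by
    rw [← h.norm_left, Complex.sq_norm, Complex.normSq_apply]; ring
  have hd : d.re ^ 2 + d.im ^ 2 = V ^ 2 := by
    rw [← h.norm_right, Complex.sq_norm, Complex.normSq_apply]; ring
  have hre := h.re_pos
  have hlt := h.re_lt
  have h1 : p 1 = ofComplex 0 := rfl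
  have h0 : p 0 = ofComplex a := rfl
  have h2 : p 2 = ofComplex V := rfl
  have h3 : p 3 = ofComplex (V + d) := rfl
  have e01 : dist (p 0) (p 1) ^ 2 = V ^ 2 := by rw [h0, h1, dist_ofComplex_sq]; simp; linarith
  have e12 : dist (p 1) (p 2) ^ 2 = V ^ 2 := by rw [h1, h2, dist_ofComplex_sq]; simp
  have e23 : dist (p 2) (p 3) ^ 2 = V ^ 2 := by rw [h2, h3, dist_ofComplex_sq]; simp; linarith
  have e02 : dist (p 0) (p 2) ^ 2 = 2 * V ^ 2 - 2 * V * a.re := by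
    rw [h0, h2, dist_ofComplex_sq]; simp; linarith
  have e13 : dist (p 1) (p 3) ^ 2 = 2 * V ^ 2 + 2 * V * d.re := by
    rw [h1, h3, dist_ofComplex_sq]; simp; linarith
  have e03 : dist (p 0) (p 3) ^ 2 = (V - a.re + d.re) ^ 2 + (a.im - d.im) ^ 2 := by
    rw [h0, h3, dist_ofComplex_sq]; simp; ring
  have hVa : 0 < V * -a.re := mul_pos hV (hre.trans hlt)
  have hVd : 0 < V * d.re := mul_pos hV hre
  have hl : V ^ 2 + 2 * (V * -a.re) + 2 * (V * d.re) < dist (p 0) (p 3) ^ 2 := by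
    rw [e03]
    nlinarith [sq_nonneg (a.im - d.im), sq_pos_of_pos (show 0 < d.re - a.re by linarith)]
  have hV2 : 0 < V ^ 2 := by positivity
  have key := chain_order (D := fun i j => dist (p i) (p j) ^ 2) hV2
    (m := dist (p 0) (p 2) ^ 2) (n := dist (p 1) (p 3) ^ 2) (l := dist (p 0) (p 3) ^ 2)
    (by rw [e02]; linarith) (by rw [e13]; linarith) (by rw [e02]; linarith)
    (by rw [e13]; linarith) (fun i j => by rw [dist_comm]) e01 e12 e23 rfl rfl rfl
    σ σ.injective (by linarith) (by
      have := dist_comm (p (σ 3)) (p (σ 1))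
      have := dist_comm (p (σ 3)) (p (σ 2))
      have := dist_comm (p (σ 2)) (p (σ 1))
      simp_all only
      linarith)
  rcases key with ⟨k0, k1, k2, k3⟩ | ⟨k0, k1, k2, k3⟩
  · ext j
    fin_cases j <;> simp [k0, k1, k2, k3]
  · exfalso
    have hB : angleB (p ∘ σ) = angleC p := by
      simp only [angleB, angleC, Function.comp_apply, k0, k1, k2]
    have hC : angleC (p ∘ σ) = angleB p := by
      simp only [angleB, angleC, Function.comp_apply, k3, k1, k2]
    have := hσ.2.1
    rw [hB, hC] at this
    exact lt_asymm this hp.2.1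

theorem IsInitialChain.connected {V : ℝ} {a d : ℂ} (hV : 0 < V) (h : IsInitialChain V a d) :
    (visibilityGraph V (chain V a d)).Connected := by
  have h01 : (visibilityGraph V (chain V a d)).Adj 0 1 := ⟨by decide, by
    rw [chain_zero, chain_one, dist_zero_right, LinearIsometryEquiv.norm_map, h.norm_left]⟩
  have h12 : (visibilityGraph V (chain V a d)).Adj 1 2 := ⟨by decide, by
    rw [chain_one, chain_two, dist_zero_left, LinearIsometryEquiv.norm_map, Complex.norm_real,
      Real.norm_eq_abs, abs_of_pos hV]⟩
  have h23 : (visibilityGraph V (chain V a d)).Adj 2 3 := ⟨by decide, by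
    rw [chain_two, chain_three, LinearIsometryEquiv.dist_map, dist_self_add_right, h.norm_right]⟩
  have hr : ∀ i, (visibilityGraph V (chain V a d)).Reachable 0 i := by
    intro i
    fin_cases i
    · exact SimpleGraph.Reachable.refl _
    · exact h01.reachable
    · exact h01.reachable.trans h12.reachable
    · exact h01.reachable.trans (h12.reachable.trans h23.reachable)
  exact SimpleGraph.connected_iff _ |>.2 ⟨fun i j => (hr i).symm.trans (hr j), ⟨0⟩⟩

theorem IsInitialChain.mem_initial {V : ℝ} {a d : ℂ} (hV : 0 < V) (h : IsInitialChain V a d) :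
    chain V a d ∈ (AE V).initial :=
  ⟨h.isConfigI hV, h.rolesDetermined hV, h.connected hV⟩

/-! ### A robot that sees at most one other robot -/

/-- The local coordinate system rotated by the unit complex number `u`. -/
noncomputable def rotationFrame (u : Circle) : Frame :=
  (ofComplex.symm.trans (rotation u)).trans ofComplex

/-- The local coordinate system reflected after a rotation by `u`. -/
noncomputable def reflectionFrame (u : Circle) : Frame :=
  ((ofComplex.symm.trans (rotation u)).trans Complex.conjLIE).trans ofComplex

theorem rotationFrame_ofComplex (u : Circle) (z : ℂ) :
    rotationFrame u (ofComplex z) = ofComplex (u * z) := by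
  simp [rotationFrame, rotation_apply]

theorem reflectionFrame_ofComplex (u : Circle) (z : ℂ) :
    reflectionFrame u (ofComplex z) = ofComplex (conj (u * z)) := by
  simp [reflectionFrame, rotation_apply]

theorem snapshot_eq_pair {V : ℝ} {n : ℕ} {p : Config n} {i j : Fin n}
    (hfar : ∀ l, l ≠ i → l ≠ j → V < dist (p i) (p l)) (hV : 0 ≤ V) (h : dist (p i) (p j) ≤ V)
    (ψ : Frame) : snapshot V .limited p ψ i = {0, ψ (p j - p i)} := by
  ext x
  simp only [snapshot, Visibility.Sees, Set.mem_ofPred_eq, Set.mem_insert_iff,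
    Set.mem_singleton_iff]
  constructor
  · rintro ⟨l, hl, rfl⟩
    by_cases hi : l = i
    · left; simp [hi]
    · by_cases hj : l = j
      · right; rw [hj]
      · exact absurd hl (hfar l hi hj).not_ge
  · rintro (rfl | rfl)
    · exact ⟨i, by simpa using hV, by simp⟩
    · exact ⟨j, h, rfl⟩

theorem snapshot_eq_singleton {V : ℝ} {n : ℕ} {p : Config n} {i j : Fin n}
    (hfar : ∀ l, l ≠ i → l ≠ j → V < dist (p i) (p l)) (hV : 0 ≤ V) (h : V < dist (p i) (p j))
    (ψ : Frame) : snapshot V .limited p ψ i = {0} := by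
  ext x
  simp only [snapshot, Visibility.Sees, Set.mem_ofPred_eq, Set.mem_singleton_iff]
  constructor
  · rintro ⟨l, hl, rfl⟩
    by_cases hi : l = i
    · simp [hi]
    · by_cases hj : l = j
      · rw [hj] at hl; exact absurd hl h.not_ge
      · exact absurd hl (hfar l hi hj).not_ge
  · rintro rfl
    exact ⟨i, by simpa using hV, by simp⟩

/-- Whatever a robot computes when it sees at most one other robot, at distance `r`, the choice of
its local coordinate system lets its position relative to this robot be multiplied by a complex
number `g` or by its conjugate. -/
theorem exists_multiplier {K : Type*} (f : K → Set Plane → K × Plane) {V r : ℝ} (hV : 0 < V)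
    (hr : 0 < r) (c : K) : ∃ (g : ℂ) (c' : K), ∀ (p : Config 4) (i j : Fin 4) (z : ℂ),
      p i = p j + ofComplex z → ‖z‖ = r →
      (∀ l, l ≠ i → l ≠ j → V < dist (p i) (p l)) → ∀ e, e = g ∨ e = conj g →
      ∃ ψ : Frame, (f c (snapshot V .limited p ψ i)).1 = c' ∧
        p i + ψ.symm (f c (snapshot V .limited p ψ i)).2 = p j + ofComplex (e * z) := by
  have hr' : (r : ℂ) ≠ 0 := by exact_mod_cast hr.ne'
  have hdist : ∀ (p : Config 4) (i j : Fin 4) (z : ℂ), p i = p j + ofComplex z → ‖z‖ = r →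
      dist (p i) (p j) = r := fun p i j z h1 h2 => by
    rw [h1, dist_self_add_left, LinearIsometryEquiv.norm_map, h2]
  by_cases hrV : r ≤ V
  · set ω := ofComplex.symm (f c {0, ofComplex (r : ℂ)}).2 with hω
    have hw : (f c {0, ofComplex (r : ℂ)}).2 = ofComplex ω := by simp [hω]
    -- The neighbor, at `-z`, is made to appear at the real point `r`. Pulled back, the destination
    -- `ω` is the displacement `-z / r * ω`, so the arm `z` becomes `(1 - ω / r) * z`; a reflected
    -- frame replaces `ω` by its conjugate.
    refine ⟨1 - ω / r, (f c {0, ofComplex (r : ℂ)}).1, ?_⟩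
    intro p i j z hz hzr hfar e he
    have hz0 : z * conj z = (r : ℂ) ^ 2 := by
      rw [Complex.mul_conj, Complex.normSq_eq_norm_sq, hzr]; push_cast; rfl
    obtain ⟨u, hu⟩ : ∃ u : Circle, (u : ℂ) = -conj z / r := by
      refine ⟨⟨-conj z / r, ?_⟩, rfl⟩
      refine mem_sphere_zero_iff_norm.2 ?_
      simp [hzr, abs_of_pos hr, hr.ne']
    have huz : (u : ℂ) * -z = r := by
      rw [hu]; field_simp; linear_combination hz0
    have hsub : p j - p i = ofComplex (-z) := by rw [hz, map_neg]; abel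
    have hsee := (hdist p i j z hz hzr).le.trans hrV
    rcases he with rfl | rfl
    · have h1 : rotationFrame u (p j - p i) = ofComplex (r : ℂ) := by
        rw [hsub, rotationFrame_ofComplex, huz]
      refine ⟨rotationFrame u, ?_, ?_⟩
      · rw [snapshot_eq_pair hfar hV.le hsee, h1]
      · have h2 : (rotationFrame u).symm (ofComplex ω) = ofComplex (-z / r * ω) := by
          rw [LinearIsometryEquiv.symm_apply_eq, rotationFrame_ofComplex]
          congr 1
          field_simp
          linear_combination (-ω) * huz
        rw [snapshot_eq_pair hfar hV.le hsee, h1, hw, h2, hz, add_assoc, ← map_add]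
        congr 2
        field_simp
        ring
    · have h1 : reflectionFrame u (p j - p i) = ofComplex (r : ℂ) := by
        rw [hsub, reflectionFrame_ofComplex, huz, Complex.conj_ofReal]
      refine ⟨reflectionFrame u, ?_, ?_⟩
      · rw [snapshot_eq_pair hfar hV.le hsee, h1]
      · have h2 : (reflectionFrame u).symm (ofComplex ω) = ofComplex (-z / r * conj ω) := by
          rw [LinearIsometryEquiv.symm_apply_eq, reflectionFrame_ofComplex]
          congr 1
          have : (u : ℂ) * (-z / r * conj ω) = conj ω := by
            field_simp
            linear_combination conj ω * huz
          rw [this, Complex.conj_conj]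
        rw [snapshot_eq_pair hfar hV.le hsee, h1, hw, h2, hz, add_assoc, ← map_add]
        congr 2
        simp only [map_sub, map_one, map_div₀, Complex.conj_ofReal]
        field_simp
        ring
  · push Not at hrV
    set ω := ofComplex.symm (f c {0}).2 with hω
    have hw : (f c {0}).2 = ofComplex ω := by simp [hω]
    -- A robot that sees only itself can be turned so that it moves straight away from `p j`; the
    -- factor is then real.
    refine ⟨((1 + ‖ω‖ / r : ℝ) : ℂ), (f c {0}).1, ?_⟩
    intro p i j z hz hzr hfar e he
    rw [Complex.conj_ofReal, or_self] at he
    have hfar' : V < dist (p i) (p j) := by rwa [hdist p i j z hz hzr]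
    obtain ⟨u, hu⟩ : ∃ u : Circle, (u : ℂ) * (‖ω‖ * z / r) = ω := by
      by_cases h0 : ω = 0
      · exact ⟨1, by simp [h0]⟩
      · have hz1 : z ≠ 0 := by rintro rfl; simp at hzr; exact hr.ne hzr
        have hω1 : (‖ω‖ : ℂ) ≠ 0 := by simpa using h0
        refine ⟨⟨ω * r / (‖ω‖ * z), ?_⟩, ?_⟩
        · refine mem_sphere_zero_iff_norm.2 ?_
          simp [hzr, abs_of_pos hr, h0, hr.ne']
        · change ω * r / (‖ω‖ * z) * (‖ω‖ * z / r) = ω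
          field_simp
    refine ⟨rotationFrame u, ?_, ?_⟩
    · rw [snapshot_eq_singleton hfar hV.le hfar']
    · have h2 : (rotationFrame u).symm (ofComplex ω) = ofComplex (‖ω‖ * z / r) := by
        rw [LinearIsometryEquiv.symm_apply_eq, rotationFrame_ofComplex, hu]
      rw [snapshot_eq_singleton hfar hV.le hfar', hw, h2, hz, add_assoc, ← map_add, he]
      congr 2
      push_cast
      field_simp

/-! ### Runs in which all robots are always active -/

/-- The positions and lights of four robots executing the protocol `A`. -/
abbrev State (A : Protocol) : Type := Config 4 × (Fin 4 → A.Color)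

/-- The outcome of a round in which all robots are active. -/
noncomputable def advance (V : ℝ) (A : Protocol) (ψ : Fin 4 → Frame) (s : State A) : State A :=
  (fun i => s.1 i + (ψ i).symm (A.compute 0 (s.2 i) (snapshot V .limited s.1 (ψ i) i)).2,
    fun i => (A.compute 0 (s.2 i) (snapshot V .limited s.1 (ψ i) i)).1)

/-- `s'` is a possible outcome of a round that starts in `s`. -/
def Step (V : ℝ) (A : Protocol) (s s' : State A) : Prop := ∃ ψ, s' = advance V A ψ s

/-- An infinite sequence of rounds from the configuration `p`. -/
def IsRun (V : ℝ) (A : Protocol) (p : Config 4) (π : ℕ → State A) : Prop :=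
  π 0 = (p, fun _ => A.off) ∧ ∀ t, Step V A (π t) (π (t + 1))

/-- The state `s` is reached from the configuration `p` in `t` rounds. -/
def Reach (V : ℝ) (A : Protocol) (p : Config 4) (t : ℕ) (s : State A) : Prop :=
  ∃ π, IsRun V A p π ∧ π t = s

variable {V : ℝ} {A : Protocol} {S : Scheduler} {p : Config 4}

/-- Activating everybody in every round is allowed under both schedulers, so one impossibility
argument serves both. -/
theorem IsRun.admissible {P : Problem V 4}
    (hA : Solves V S .limited (anonymousTeam 4 (by norm_num)) A P) (hp : p ∈ P.initial)
    {π : ℕ → State A} (hπ : IsRun V A p π) : (fun t => (π t).1) ∈ P.admissible := by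
  choose φ hφ using hπ.2
  refine hA p hp _ (S.allows_univ (by norm_num)) φ trivial _ (fun t => (π t).2)
    ⟨by rw [hπ.1], fun i => by rw [hπ.1], fun t i hi => absurd trivial hi, fun t i _ => ?_,
      fun t i _ => moveEndsAt_top.2 ?_⟩
  · rw [hφ t]; rfl
  · rw [hφ t]; rfl

/-- The run in which the local coordinate systems agree. -/
noncomputable def aligned (V : ℝ) (A : Protocol) (s : State A) (t : ℕ) : State A :=
  (advance V A fun _ => LinearIsometryEquiv.refl ℝ Plane)^[t] s

theorem aligned_succ (s : State A) (t : ℕ) : aligned V A s (t + 1) =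
    advance V A (fun _ => LinearIsometryEquiv.refl ℝ Plane) (aligned V A s t) :=
  Function.iterate_succ_apply' _ _ _

/-- Admissibility concerns infinite evolutions, so a finite prefix has to be prolonged before it can
be applied. -/
theorem Reach.append {t : ℕ} {s : State A} (h : Reach V A p t s) {ρ : ℕ → State A}
    (h0 : ρ 0 = s) (hρ : ∀ u, Step V A (ρ u) (ρ (u + 1))) :
    ∃ π, IsRun V A p π ∧ ∀ u, π (t + u) = ρ u := by
  obtain ⟨π, hπ, rfl⟩ := h
  refine ⟨fun v => if v ≤ t then π v else ρ (v - t), ⟨by simpa using hπ.1, fun v => ?_⟩,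
    fun u => ?_⟩
  · rcases lt_trichotomy v t with hv | rfl | hv
    · simpa [hv.le, Nat.succ_le_of_lt hv] using hπ.2 v
    · have := hρ 0
      rw [h0] at this
      simpa using this
    · have := hρ (v - t)
      rw [← Nat.sub_add_comm hv.le] at this
      simpa [hv.not_ge, (Nat.lt_succ_of_lt hv).not_ge] using this
  · rcases Nat.eq_zero_or_pos u with rfl | hu
    · simp [h0]
    · simp [hu.ne']

theorem Reach.step {t : ℕ} {s s' : State A} (h : Reach V A p t s) (hs : Step V A s s') :
    Reach V A p (t + 1) s' := by
  obtain ⟨π, hπ, h1⟩ := h.append (ρ := fun u => Nat.casesOn u s fun u => aligned V A s' u) rfl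
    (fun u => by
      cases u with
      | zero => exact hs
      | succ u => exact ⟨_, aligned_succ s' u⟩)
  exact ⟨π, hπ, h1 1⟩

theorem Reach.exists_aligned {t : ℕ} {s : State A} (h : Reach V A p t s) :
    ∃ π, IsRun V A p π ∧ ∀ u, π (t + u) = aligned V A s u :=
  h.append rfl fun u => ⟨_, aligned_succ s u⟩

theorem IsRun.reach {π : ℕ → State A} (h : IsRun V A p π) (t : ℕ) : Reach V A p t (π t) :=
  ⟨π, h, rfl⟩

section Solution

variable (hA : Solves V S .limited (anonymousTeam 4 (by norm_num)) A (AE V))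
include hA

theorem Reach.fixed (hp : p ∈ (AE V).initial) {t : ℕ} {s : State A} (h : Reach V A p t s) :
    s.1 1 = p 1 ∧ s.1 2 = p 2 := by
  obtain ⟨π, hπ, rfl⟩ := h
  have h1 := (hπ.admissible hA hp).1 t
  simp only [hπ.1] at h1
  exact h1

theorem Reach.collisionFree (hp : p ∈ (AE V).initial) {t : ℕ} {s s' : State A}
    (h : Reach V A p t s) (hs : Step V A s s') {x : ℝ} (hx : x ∈ Set.Icc (0 : ℝ) 1) :
    Function.Injective fun i => AffineMap.lineMap (s.1 i) (s'.1 i) x := by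
  obtain ⟨π, hπ, h1⟩ := h.append (ρ := fun u => Nat.casesOn u s fun u => aligned V A s' u) rfl
    (fun u => by
      cases u with
      | zero => exact hs
      | succ u => exact ⟨_, aligned_succ s' u⟩)
  have h2 := (hπ.admissible hA hp).2.1 t x hx
  have e0 : π t = s := h1 0
  have e1 : π (t + 1) = s' := h1 1
  simpa only [e0, e1] using h2

end Solution

/-! ### One round of a chain -/

/-- With color `c` and at distance `r` from the only robot that it may see, a robot can be made
to multiply its relative position by `g` or by its conjugate, and gets the color `c'`. -/
def IsMultiplier (V : ℝ) (A : Protocol) (r : ℝ) (c : A.Color) (g : ℂ) (c' : A.Color) : Prop :=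
  ∀ (p : Config 4) (i j : Fin 4) (z : ℂ),
    p i = p j + ofComplex z → ‖z‖ = r →
    (∀ l, l ≠ i → l ≠ j → V < dist (p i) (p l)) → ∀ e, e = g ∨ e = conj g →
    ∃ ψ : Frame, (A.compute 0 c (snapshot V .limited p ψ i)).1 = c' ∧
      p i + ψ.symm (A.compute 0 c (snapshot V .limited p ψ i)).2 = p j + ofComplex (e * z)

theorem lt_dist_ofComplex {x : ℝ} {z w : ℂ} (h : x < |(z - w).re|) :
    x < dist (ofComplex z) (ofComplex w) := by
  rw [LinearIsometryEquiv.dist_map, dist_eq_norm]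
  exact h.trans_le (Complex.abs_re_le_norm _)

/-- As the arms point outwards, the real parts alone differ by more than `V`, however long the arms
are. -/
theorem chain_far_left {a d : ℂ} (ha : a.re < 0) (hd : 0 < d.re) :
    ∀ l, l ≠ 0 → l ≠ 1 → V < dist (chain V a d 0) (chain V a d l) := by
  intro l h0 h1
  fin_cases l
  · exact absurd rfl h0
  · exact absurd rfl h1
  · refine lt_dist_ofComplex (lt_abs.2 (Or.inr ?_))
    simp; linarith
  · refine lt_dist_ofComplex (lt_abs.2 (Or.inr ?_))
    simp; linarith

theorem chain_far_right {a d : ℂ} (ha : a.re < 0) (hd : 0 < d.re) :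
    ∀ l, l ≠ 3 → l ≠ 2 → V < dist (chain V a d 3) (chain V a d l) := by
  intro l h3 h2
  fin_cases l
  · refine lt_dist_ofComplex (lt_abs.2 (Or.inl ?_))
    simp; linarith
  · refine lt_dist_ofComplex (lt_abs.2 (Or.inl ?_))
    simp; linarith
  · exact absurd rfl h2
  · exact absurd rfl h3

theorem config_eq_chain {q : Config 4} {a d : ℂ} (h0 : q 0 = ofComplex a) (h1 : q 1 = 0)
    (h2 : q 2 = ofComplex V) (h3 : q 3 = ofComplex (V + d)) : q = chain V a d := by
  funext i
  fin_cases i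
  · exact h0
  · exact h1.trans (chain_one V a d).symm
  · exact h2
  · exact h3

section Solution

variable (hV : 0 < V) (hA : Solves V S .limited (anonymousTeam 4 (by norm_num)) A (AE V))
include hV hA

theorem Reach.exists_chain_step {a₀ d₀ : ℂ} (hi : IsInitialChain V a₀ d₀) {t : ℕ} {s : State A}
    (h : Reach V A (chain V a₀ d₀) t s) {a d : ℂ} (hs : s.1 = chain V a d) {r : ℝ}
    (ha : ‖a‖ = r) (hd : ‖d‖ = r) (ha' : a.re < 0) (hd' : 0 < d.re) {c : A.Color}
    (h0 : s.2 0 = c) (h3 : s.2 3 = c) {g : ℂ} {c' : A.Color} (hg : IsMultiplier V A r c g c')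
    {e₀ e₃ : ℂ} (he₀ : e₀ = g ∨ e₀ = conj g) (he₃ : e₃ = g ∨ e₃ = conj g) :
    ∃ s', Step V A s s' ∧ s'.1 = chain V (e₀ * a) (e₃ * d) ∧ s'.2 0 = c' ∧ s'.2 3 = c' := by
  obtain ⟨ψ₀, hc₀, hp₀⟩ := hg (chain V a d) 0 1 a (by rw [chain_zero, chain_one, zero_add]) ha
    (chain_far_left ha' hd') e₀ he₀
  obtain ⟨ψ₃, hc₃, hp₃⟩ := hg (chain V a d) 3 2 d (by rw [chain_three, chain_two, map_add]) hd
    (chain_far_right ha' hd') e₃ he₃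
  -- The frames of `r₂` and `r₃` are arbitrary: these robots cannot move in any run of a solution.
  set s' := advance V A ![ψ₀, ψ₀, ψ₃, ψ₃] s with hs'
  have hst : Step V A s s' := ⟨_, hs'⟩
  obtain ⟨f1, f2⟩ := Reach.fixed hA (hi.mem_initial hV) (h.step hst)
  refine ⟨s', hst, config_eq_chain ?_ (f1.trans (chain_one V a₀ d₀)) f2 ?_, ?_, ?_⟩
  · rw [chain_one, zero_add, ← hs, ← h0] at hp₀
    exact hp₀
  · rw [chain_two, ← map_add, ← hs, ← h3] at hp₃
    exact hp₃
  · rw [← hs, ← h0] at hc₀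
    exact hc₀
  · rw [← hs, ← h3] at hc₃
    exact hc₃

/-- A robot does not pass through its neighbor. -/
theorem Reach.multiplier_not_nonpos {a₀ d₀ : ℂ} (hi : IsInitialChain V a₀ d₀) {t : ℕ}
    {s : State A} (h : Reach V A (chain V a₀ d₀) t s) {a d : ℂ} (hs : s.1 = chain V a d) {r : ℝ}
    (ha : ‖a‖ = r) (hd : ‖d‖ = r) (ha' : a.re < 0) (hd' : 0 < d.re) {c : A.Color}
    (h0 : s.2 0 = c) (h3 : s.2 3 = c) {g : ℂ} {c' : A.Color} (hg : IsMultiplier V A r c g c')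
    (him : g.im = 0) : 0 < g.re := by
  by_contra! hre
  obtain ⟨s', hst, hp, -, -⟩ := h.exists_chain_step hV hA hi hs ha hd ha' hd' h0 h3 hg
    (Or.inl rfl) (Or.inl rfl)
  have hx : 0 < 1 - g.re := by linarith
  -- At this time `x` the moving arm `((1 - x) + x * g) * d` vanishes, so `r₄` is at `r₃`.
  have hinj := h.collisionFree hA (hi.mem_initial hV) hst (x := 1 / (1 - g.re))
    ⟨by positivity, by rw [div_le_one hx]; linarith⟩
  have hgre : g = (g.re : ℂ) := Complex.ext rfl (by simpa using him)
  have : (3 : Fin 4) = 2 := by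
    apply hinj
    dsimp only
    rw [hs, hp, chain_three, chain_two, chain_three, chain_two, AffineMap.lineMap_same_apply,
      AffineMap.lineMap_apply_module, ← map_smul, ← map_smul, ← map_add]
    congr 1
    rw [hgre, Complex.real_smul, Complex.real_smul]
    have : (1 - g.re : ℂ) ≠ 0 := by exact_mod_cast hx.ne'
    push_cast
    simp only [Complex.ofReal_re]
    field_simp
    ring
  exact absurd this (by decide)

end Solution

/-! ### Complex numbers -/

theorem norm_of_sq_eq {m : ℝ} {z z₀ : ℂ} (h : z ^ 2 = m * z₀ ^ 2) (h0 : ‖z₀‖ = V) (hV : 0 < V) :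
    ‖z‖ = V * √|m| := by
  have h1 : ‖z‖ ^ 2 = |m| * V ^ 2 := by
    rw [← norm_pow, h, norm_mul, norm_pow, h0, Complex.norm_real, Real.norm_eq_abs]
  rw [← Real.sqrt_sq (norm_nonneg z), h1, Real.sqrt_mul (abs_nonneg m), Real.sqrt_sq hV.le,
    mul_comm]

/-- Twice the squared real part is the squared norm plus the real part of the square. For fixed `m`
and `V` it is thus affine in `z₀.re ^ 2`, with slope `2 * m`. -/
theorem re_sq_of_sq_eq {m : ℝ} {z z₀ : ℂ} (h : z ^ 2 = m * z₀ ^ 2) (h0 : ‖z₀‖ = V) :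
    2 * z.re ^ 2 = |m| * V ^ 2 + m * (2 * z₀.re ^ 2 - V ^ 2) := by
  have h1 : ‖z‖ ^ 2 = |m| * V ^ 2 := by
    rw [← norm_pow, h, norm_mul, norm_pow, h0, Complex.norm_real, Real.norm_eq_abs]
  have h2 : z₀.re ^ 2 + z₀.im ^ 2 = V ^ 2 := by
    rw [← h0, Complex.sq_norm, Complex.normSq_apply]; ring
  rw [Complex.sq_norm, Complex.normSq_apply] at h1
  have h3 := congrArg Complex.re h
  simp only [pow_two, Complex.mul_re, Complex.ofReal_re, Complex.ofReal_im, zero_mul,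
    sub_zero] at h3
  linear_combination h1 + h3 - m * h2

theorem eq_of_sq_eq_of_re_pos {z w : ℂ} (h : z ^ 2 = w ^ 2) (hzw : 0 < z.re * w.re) : z = w := by
  rcases sq_eq_sq_iff_eq_or_eq_neg.1 h with h | h
  · exact h
  · rw [h, Complex.neg_re] at hzw
    nlinarith [sq_nonneg w.re]

/-- Traces a desired current arm back to an initial arm. -/
theorem exists_root {m : ℝ} (hm : m ≠ 0) {δ : ℂ} (hδ : ‖δ‖ = V * √|m|)
    (hre : 0 < δ.re) (him : δ.im ≠ 0) :
    ∃ z : ℂ, δ ^ 2 = m * z ^ 2 ∧ ‖z‖ = V ∧ 0 < z.re ∧ z.im ≠ 0 := by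
  obtain ⟨z, hz⟩ := IsAlgClosed.exists_pow_nat_eq (δ ^ 2 / m) (n := 2) (by norm_num)
  have hm' : (m : ℂ) ≠ 0 := by exact_mod_cast hm
  have h1 : δ ^ 2 = m * z ^ 2 := by rw [hz]; field_simp
  have h2 := norm_of_sq_eq h1 rfl (z₀ := z) (V := ‖z‖) (norm_pos_iff.2 (by
    rintro rfl
    have : δ = 0 := by simpa using h1
    rw [this] at hre
    simp at hre))
  have h3 : ‖z‖ = V := by
    rw [hδ] at h2
    exact (mul_right_cancel₀ (Real.sqrt_ne_zero'.2 (abs_pos.2 hm)) h2).symm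
  have h4 := congrArg Complex.im h1
  simp only [pow_two, Complex.mul_im, Complex.mul_re, Complex.ofReal_re, Complex.ofReal_im,
    zero_mul, add_zero] at h4
  have h5 : z.re * z.im ≠ 0 := by
    intro h
    have : δ.re * δ.im = 0 := by linear_combination h4 / 2 + m * h
    exact (mul_ne_zero hre.ne' him) this
  rcases lt_or_gt_of_ne (left_ne_zero_of_mul h5) with h | h
  · exact ⟨-z, by rw [neg_sq, h1], by rw [norm_neg, h3], by simpa using h,
      by simpa using right_ne_zero_of_mul h5⟩
  · exact ⟨z, h1, h3, h, right_ne_zero_of_mul h5⟩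

/-- If `g` is neither real nor imaginary, then two points in the right half plane are mapped to the
same point by `g` and its conjugate. -/
theorem exists_merge {g : ℂ} (hre : g.re ≠ 0) (him : g.im ≠ 0) {r : ℝ} (hr : 0 < r) :
    ∃ δ₁ δ₂ : ℂ, ‖δ₁‖ = r ∧ ‖δ₂‖ = r ∧ 0 < δ₁.re ∧ 0 < δ₂.re ∧ δ₁.im ≠ 0 ∧ δ₂.im ≠ 0 ∧
      δ₁.re ≠ δ₂.re ∧ g * δ₁ = conj g * δ₂ := by
  set x := g.re
  set y := g.im
  have hx2 : 0 < x ^ 2 := by positivity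
  have hy2 : 0 < y ^ 2 := by positivity
  -- With `η = x + k * y * i`, the points `conj g * η` and `g * η` have the common image `‖g‖ ^ 2 *
  -- η`. Their real parts are `x ^ 2 ± k * y ^ 2`: a small `k` keeps both positive, `k ≠ 0` makes
  -- them different, and `k ≠ 1` keeps the imaginary parts nonzero.
  set k : ℝ := x ^ 2 / (2 * (x ^ 2 + y ^ 2)) with hk
  have hk0 : 0 < k := by positivity
  have hk1 : k < 1 := by rw [hk, div_lt_one (by positivity)]; linarith
  have hk2 : k * y ^ 2 < x ^ 2 := by
    rw [hk, div_mul_eq_mul_div, div_lt_iff₀ (by positivity)]; nlinarith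
  set η : ℂ := ⟨x, k * y⟩ with hη
  have hη0 : η ≠ 0 := fun h => hre (congrArg Complex.re h)
  have hg0 : g ≠ 0 := fun h => hre (congrArg Complex.re h)
  have hN : 0 < ‖g‖ * ‖η‖ := by positivity
  set ρ : ℝ := r / (‖g‖ * ‖η‖) with hρ
  have hρ0 : 0 < ρ := by positivity
  have hnorm : ρ * (‖g‖ * ‖η‖) = r := by rw [hρ]; field_simp
  have re1 : ((ρ : ℂ) * (conj g * η)).re = ρ * (x ^ 2 + k * y ^ 2) := by
    simp [hη]; left; ring
  have re2 : ((ρ : ℂ) * (g * η)).re = ρ * (x ^ 2 - k * y ^ 2) := by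
    simp [hη]; left; ring
  have im1 : ((ρ : ℂ) * (conj g * η)).im = ρ * (x * y * (k - 1)) := by
    simp [hη]; left; ring
  have im2 : ((ρ : ℂ) * (g * η)).im = ρ * (x * y * (k + 1)) := by
    simp [hη]; left; ring
  refine ⟨ρ * (conj g * η), ρ * (g * η), ?_, ?_, ?_, ?_, ?_, ?_, ?_, by ring⟩
  · rw [norm_mul, norm_mul, Complex.norm_real, Real.norm_eq_abs, abs_of_pos hρ0,
      RCLike.norm_conj, hnorm]
  · rw [norm_mul, norm_mul, Complex.norm_real, Real.norm_eq_abs, abs_of_pos hρ0, hnorm]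
  · rw [re1]; positivity
  · rw [re2]; exact mul_pos hρ0 (by linarith)
  · rw [im1]; exact mul_ne_zero hρ0.ne' (mul_ne_zero (mul_ne_zero hre him) (by linarith))
  · rw [im2]; exact mul_ne_zero hρ0.ne' (mul_ne_zero (mul_ne_zero hre him) (by linarith))
  · rw [re1, re2]
    intro h
    have h1 := mul_left_cancel₀ hρ0.ne' h
    have : 0 < k * y ^ 2 := by positivity
    linarith

theorem exists_left {x : ℝ} (hx : 0 < x) (hxV : x < V) :
    ∃ a : ℂ, ‖a‖ = V ∧ x < -a.re ∧ a.im ≠ 0 := by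
  obtain ⟨y, h1, h2⟩ := exists_between hxV
  have h3 : 0 < V ^ 2 - y ^ 2 := by nlinarith
  refine ⟨⟨-y, √(V ^ 2 - y ^ 2)⟩, ?_, by simpa using h1, (Real.sqrt_pos.2 h3).ne'⟩
  rw [← Real.sqrt_sq (norm_nonneg _), Complex.sq_norm, Complex.normSq_mk,
    Real.mul_self_sqrt h3.le, neg_mul_neg, ← pow_two, add_sub_cancel, Real.sqrt_sq (by linarith)]

theorem exists_isInitialChain (hV : 0 < V) : ∃ a d, IsInitialChain V a d := by
  obtain ⟨d, h1, h2, h3⟩ := exists_left (x := V / 2) (V := V) (by linarith) (by linarith)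
  have h4 := neg_re_lt_norm h3
  rw [h1] at h4
  obtain ⟨a, h5, h6, h7⟩ := exists_left (x := -d.re) (V := V) (by linarith) h4
  exact ⟨a, -d, h5, by rw [norm_neg, h1], by rw [Complex.neg_re]; linarith, h6, h7⟩

/-! ### Angle equalization under limited visibility -/

/-- The state `s` is a chain with colors `c` at its ends, whose arms have the same squares as those
of the chain given by `a₀` and `d₀`, up to the common factor `m`. -/
structure IsSimilar (V : ℝ) {A : Protocol} (m : ℝ) (c : A.Color) (a₀ d₀ : ℂ) (s : State A)
    (a d : ℂ) : Prop where
  pos_eq : s.1 = chain V a d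
  light_zero : s.2 0 = c
  light_three : s.2 3 = c
  sq_left : a ^ 2 = m * a₀ ^ 2
  sq_right : d ^ 2 = m * d₀ ^ 2
  re_left : a.re < 0
  re_right : 0 < d.re

/-- From all initial chains a state is reached in `t` rounds that is similar in the same way. -/
def Uniform (V : ℝ) (A : Protocol) (t : ℕ) (m : ℝ) (c : A.Color) : Prop :=
  m ≠ 0 ∧ ∀ a₀ d₀, IsInitialChain V a₀ d₀ →
    ∃ s a d, Reach V A (chain V a₀ d₀) t s ∧ IsSimilar V m c a₀ d₀ s a d

theorem uniform_zero : Uniform V A 0 1 A.off := by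
  refine ⟨one_ne_zero, fun a₀ d₀ h => ⟨(chain V a₀ d₀, fun _ => A.off), a₀, d₀, ?_,
    rfl, rfl, rfl, by simp, by simp, ?_, h.re_pos⟩⟩
  · exact ⟨aligned V A _, ⟨rfl, fun u => ⟨_, aligned_succ _ u⟩⟩, rfl⟩
  · linarith [h.re_pos, h.re_lt]

theorem exists_isMultiplier (hV : 0 < V) {m : ℝ} (hm : m ≠ 0) (c : A.Color) :
    ∃ g c', IsMultiplier V A (V * √|m|) c g c' :=
  exists_multiplier (A.compute 0) hV (mul_pos hV (Real.sqrt_pos.2 (abs_pos.2 hm))) c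

/-- The arms have equal length, so equal angles would force equal squared real parts, and by
`re_sq_of_sq_eq` also equal initial ones. -/
theorem IsSimilar.angle_ne (hV : 0 < V) {m : ℝ} (hm : m ≠ 0) {c : A.Color} {a₀ d₀ : ℂ}
    (hi : IsInitialChain V a₀ d₀) {s : State A} {a d : ℂ} (hs : IsSimilar V m c a₀ d₀ s a d) :
    angleB s.1 ≠ angleC s.1 := by
  intro h
  have na := norm_of_sq_eq hs.sq_left hi.norm_left hV
  have nd := norm_of_sq_eq hs.sq_right hi.norm_right hV
  have hR : 0 < V * √|m| := mul_pos hV (Real.sqrt_pos.2 (abs_pos.2 hm))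
  have ba := abs_le.1 ((Complex.abs_re_le_norm a).trans na.le)
  have bd := abs_le.1 ((Complex.abs_re_le_norm d).trans nd.le)
  rw [hs.pos_eq, angleB_chain hV, angleC_chain hV, na, nd] at h
  have h1 := Real.arccos_injOn
    ⟨by rw [le_div_iff₀ hR]; linarith, (div_le_one hR).2 (by linarith)⟩
    ⟨by rw [le_div_iff₀ hR]; linarith, (div_le_one hR).2 bd.2⟩ h
  have h2 : -a.re = d.re := (div_left_inj' hR.ne').1 h1
  have ka := re_sq_of_sq_eq hs.sq_left hi.norm_left
  have kd := re_sq_of_sq_eq hs.sq_right hi.norm_right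
  rw [← h2, neg_sq, ka] at kd
  have h3 : m * (a₀.re ^ 2 - d₀.re ^ 2) = 0 := by linarith
  have h4 : a₀.re ^ 2 - d₀.re ^ 2 ≠ 0 := by
    have h5 := hi.re_pos
    have h6 := hi.re_lt
    nlinarith
  exact mul_ne_zero hm h4 h3

section Solution

variable (hV : 0 < V) (hA : Solves V S .limited (anonymousTeam 4 (by norm_num)) A (AE V))
include hV hA

/-- Two states that agree for the robots `r₁` and `r₄` and are reached from initial chains cannot
be distinguished any more. -/
theorem Reach.aligned_eq {a₁ d₁ a₂ d₂ : ℂ} (h₁ : IsInitialChain V a₁ d₁)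
    (h₂ : IsInitialChain V a₂ d₂) {t₁ t₂ : ℕ} {s₁ s₂ : State A}
    (r₁ : Reach V A (chain V a₁ d₁) t₁ s₁) (r₂ : Reach V A (chain V a₂ d₂) t₂ s₂)
    (hpos : s₁.1 = s₂.1) (h0 : s₁.2 0 = s₂.2 0) (h3 : s₁.2 3 = s₂.2 3) (u : ℕ) :
    (aligned V A s₁ u).1 = (aligned V A s₂ u).1 := by
  obtain ⟨π₁, hπ₁, e₁⟩ := r₁.exists_aligned
  obtain ⟨π₂, hπ₂, e₂⟩ := r₂.exists_aligned
  -- The lights of `r₂` and `r₃` may differ, but nobody else sees them and these two robots stay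
  -- fixed anyway.
  suffices h : (aligned V A s₁ u).1 = (aligned V A s₂ u).1 ∧
      (aligned V A s₁ u).2 0 = (aligned V A s₂ u).2 0 ∧
      (aligned V A s₁ u).2 3 = (aligned V A s₂ u).2 3 from h.1
  induction u with
  | zero => exact ⟨hpos, h0, h3⟩
  | succ u ih =>
    obtain ⟨ip, i0, i3⟩ := ih
    have f₁ := Reach.fixed hA (h₁.mem_initial hV) (hπ₁.reach (t₁ + (u + 1)))
    have f₂ := Reach.fixed hA (h₂.mem_initial hV) (hπ₂.reach (t₂ + (u + 1)))
    rw [e₁, chain_one, chain_two] at f₁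
    rw [e₂, chain_one, chain_two] at f₂
    refine ⟨?_, ?_, ?_⟩
    · funext i
      fin_cases i
      · change (aligned V A s₁ (u + 1)).1 0 = (aligned V A s₂ (u + 1)).1 0
        simp only [aligned_succ, advance, ip, i0]
      · exact f₁.1.trans f₂.1.symm
      · exact f₁.2.trans f₂.2.symm
      · change (aligned V A s₁ (u + 1)).1 3 = (aligned V A s₂ (u + 1)).1 3
        simp only [aligned_succ, advance, ip, i3]
    · simp only [aligned_succ, advance, ip, i0]
    · simp only [aligned_succ, advance, ip, i3]

/-- Otherwise two initial chains with the same left arm and different θ₂ are merged by applying `g`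
to one right arm and its conjugate to the other. Uniformity ensures that `m` and `c`, and hence `g`,
are the same for both chains. -/
theorem Uniform.multiplier {t : ℕ} {m : ℝ} {c : A.Color} (h : Uniform V A t m c) {g : ℂ}
    {c' : A.Color} (hg : IsMultiplier V A (V * √|m|) c g c') : g.re = 0 ∨ g.im = 0 := by
  by_contra! hne
  obtain ⟨δ₁, δ₂, n₁, n₂, re₁, re₂, im₁, im₂, hre, hmerge⟩ :=
    exists_merge hne.1 hne.2 (mul_pos hV (Real.sqrt_pos.2 (abs_pos.2 h.1)))
  obtain ⟨d₁, sq₁, nd₁, dre₁, dim₁⟩ := exists_root h.1 n₁ re₁ im₁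
  obtain ⟨d₂, sq₂, nd₂, dre₂, dim₂⟩ := exists_root h.1 n₂ re₂ im₂
  have lt₁ : d₁.re < V := nd₁ ▸ (le_abs_self _).trans_lt (Complex.abs_re_lt_norm.2 dim₁)
  have lt₂ : d₂.re < V := nd₂ ▸ (le_abs_self _).trans_lt (Complex.abs_re_lt_norm.2 dim₂)
  obtain ⟨a₀, na, hlt, ima⟩ := exists_left (lt_max_of_lt_left dre₁) (max_lt lt₁ lt₂)
  have h₁ : IsInitialChain V a₀ d₁ := ⟨na, nd₁, dre₁, (le_max_left _ _).trans_lt hlt, ima⟩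
  have h₂ : IsInitialChain V a₀ d₂ := ⟨na, nd₂, dre₂, (le_max_right _ _).trans_lt hlt, ima⟩
  obtain ⟨s₁, a, δ, r₁, S₁⟩ := h.2 a₀ d₁ h₁
  obtain rfl : δ = δ₁ := eq_of_sq_eq_of_re_pos (S₁.sq_right.trans sq₁.symm)
    (mul_pos S₁.re_right re₁)
  obtain ⟨s₂, a', δ', r₂, S₂⟩ := h.2 a₀ d₂ h₂
  obtain rfl : δ' = δ₂ := eq_of_sq_eq_of_re_pos (S₂.sq_right.trans sq₂.symm)
    (mul_pos S₂.re_right re₂)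
  obtain rfl : a' = a := eq_of_sq_eq_of_re_pos (S₂.sq_left.trans S₁.sq_left.symm)
    (mul_pos_of_neg_of_neg S₂.re_left S₁.re_left)
  have hna := norm_of_sq_eq S₁.sq_left na hV
  obtain ⟨s₁', st₁, p₁, c₁, c₁'⟩ := r₁.exists_chain_step hV hA h₁ S₁.pos_eq hna n₁ S₁.re_left
    S₁.re_right S₁.light_zero S₁.light_three hg (Or.inl rfl) (Or.inl rfl)
  obtain ⟨s₂', st₂, p₂, c₂, c₂'⟩ := r₂.exists_chain_step hV hA h₂ S₂.pos_eq hna n₂ S₂.re_left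
    S₂.re_right S₂.light_zero S₂.light_three hg (Or.inl rfl) (Or.inr rfl)
  have same := Reach.aligned_eq hV hA h₁ h₂ (r₁.step st₁) (r₂.step st₂)
    (by rw [p₁, p₂, hmerge]) (c₁.trans c₂.symm) (c₁'.trans c₂'.symm)
  obtain ⟨π₁, hπ₁, e₁⟩ := (r₁.step st₁).exists_aligned
  obtain ⟨π₂, hπ₂, e₂⟩ := (r₂.step st₂).exists_aligned
  obtain ⟨-, -, T₁, rest₁, -, C₁⟩ := hπ₁.admissible hA (h₁.mem_initial hV)
  obtain ⟨-, -, T₂, rest₂, -, C₂⟩ := hπ₂.admissible hA (h₂.mem_initial hV)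
  -- A common time at which both runs are at rest; the shared configuration would have to show both
  -- values of θ₂.
  have q₁ := rest₁ (t + 1 + max T₁ T₂) ((le_max_left _ _).trans (Nat.le_add_left _ _))
  have q₂ := rest₂ (t + 1 + max T₁ T₂) ((le_max_right _ _).trans (Nat.le_add_left _ _))
  dsimp only at q₁ q₂ C₁ C₂
  rw [e₁, same] at q₁
  rw [e₂] at q₂
  rw [← q₁, hπ₁.1] at C₁
  rw [← q₂, hπ₂.1, C₁] at C₂
  rw [angleC_chain hV, angleC_chain hV, nd₁, nd₂] at C₂
  have hpos₁ : 0 < d₁.re / V := by positivity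
  have hpos₂ : 0 < d₂.re / V := by positivity
  have h4 := Real.arccos_injOn ⟨by linarith, (div_le_one hV).2 lt₁.le⟩
    ⟨by linarith, (div_le_one hV).2 lt₂.le⟩ C₂
  have h5 : d₁.re = d₂.re := by field_simp at h4; exact h4
  have k₁ := re_sq_of_sq_eq sq₁ nd₁
  have k₂ := re_sq_of_sq_eq sq₂ nd₂
  rw [h5, ← k₂] at k₁
  exact hre ((pow_left_inj₀ re₁.le re₂.le two_ne_zero).1 (by linarith))

/-- The adversary keeps the arms similar to the initial ones for another round. -/
theorem Uniform.next {t : ℕ} {m : ℝ} {c : A.Color} (h : Uniform V A t m c) :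
    ∃ m' c', Uniform V A (t + 1) m' c' ∧ ∀ a₀ d₀ s a d, IsInitialChain V a₀ d₀ →
      Reach V A (chain V a₀ d₀) t s → IsSimilar V m c a₀ d₀ s a d →
      ∃ s' a' d', Step V A s s' ∧ IsSimilar V m' c' a₀ d₀ s' a' d' := by
  obtain ⟨g, c', hg⟩ := exists_isMultiplier hV h.1 c
  have hcase := h.multiplier hV hA hg
  have hsq : g ^ 2 = ((g ^ 2).re : ℂ) ∧ (conj g) ^ 2 = ((g ^ 2).re : ℂ) := by
    constructor <;> rcases hcase with h0 | h0 <;>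
      apply Complex.ext <;> simp [pow_two, h0]
  have next : ∀ a₀ d₀ s a d, IsInitialChain V a₀ d₀ →
      Reach V A (chain V a₀ d₀) t s → IsSimilar V m c a₀ d₀ s a d →
      ((g ^ 2).re ≠ 0 ∧
      ∃ s' a' d', Step V A s s' ∧ IsSimilar V (m * (g ^ 2).re) c' a₀ d₀ s' a' d') := by
    intro a₀ d₀ s a d hi hr hs
    have na := norm_of_sq_eq hs.sq_left hi.norm_left hV
    have nd := norm_of_sq_eq hs.sq_right hi.norm_right hV
    have hpos : g.im = 0 → 0 < g.re := hr.multiplier_not_nonpos hV hA hi hs.pos_eq na nd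
      hs.re_left hs.re_right hs.light_zero hs.light_three hg
    have hg0 : g ≠ 0 := by
      rintro rfl
      exact lt_irrefl _ (hpos rfl)
    refine ⟨fun h0 => hg0 ?_, ?_⟩
    · rw [h0] at hsq
      simpa using hsq.1
    -- For imaginary `g` the two candidate images of `z` are opposite, and off the imaginary axis
    -- because `z` is not real; so one of them lies in the half plane of `z`.
    have choice : ∀ z z₀ : ℂ, z ^ 2 = m * z₀ ^ 2 → z₀.re ≠ 0 → z₀.im ≠ 0 → z.re ≠ 0 →
        ∃ e, (e = g ∨ e = conj g) ∧ 0 < (e * z).re * z.re := by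
      intro z z₀ hz hre him hzre
      rcases hcase with h0 | h0
      · have hgi : g.im ≠ 0 := fun h1 => hg0 (Complex.ext h0 h1)
        have hzi : z.im ≠ 0 := by
          intro h1
          have h2 := congrArg Complex.im hz
          simp only [pow_two, Complex.mul_im, Complex.mul_re, Complex.ofReal_re,
            Complex.ofReal_im, zero_mul, add_zero, h1, mul_zero] at h2
          have h3 : m * (z₀.re * z₀.im) = 0 := by linarith
          exact mul_ne_zero h.1 (mul_ne_zero hre him) h3
        rcases lt_or_gt_of_ne (mul_ne_zero (mul_ne_zero hgi hzi) hzre) with h1 | h1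
        · refine ⟨g, Or.inl rfl, ?_⟩
          simp only [Complex.mul_re, h0]
          linarith
        · refine ⟨conj g, Or.inr rfl, ?_⟩
          simp only [Complex.mul_re, Complex.conj_re, Complex.conj_im, h0]
          linarith
      · refine ⟨g, Or.inl rfl, ?_⟩
        simp only [Complex.mul_re, h0]
        have := mul_pos (hpos h0) (sq_pos_of_ne_zero hzre)
        linarith
    have hd0im : d₀.im ≠ 0 := by
      intro h0
      have h1 : ‖d₀‖ = d₀.re := by
        rw [← abs_of_pos hi.re_pos]
        exact (Complex.abs_re_eq_norm.2 h0).symm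
      have h2 := neg_re_lt_norm hi.im_ne
      linarith [hi.norm_left, hi.norm_right, hi.re_lt]
    obtain ⟨e₀, he₀, ha⟩ := choice a a₀ hs.sq_left (by linarith [hi.re_pos, hi.re_lt]) hi.im_ne
      hs.re_left.ne
    obtain ⟨e₃, he₃, hd⟩ := choice d d₀ hs.sq_right hi.re_pos.ne' hd0im hs.re_right.ne'
    obtain ⟨s', hst, hp, h0, h3⟩ := hr.exists_chain_step hV hA hi hs.pos_eq na nd hs.re_left
      hs.re_right hs.light_zero hs.light_three hg he₀ he₃
    have esq : ∀ e, (e = g ∨ e = conj g) → e ^ 2 = ((g ^ 2).re : ℂ) := by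
      rintro e (rfl | rfl)
      exacts [hsq.1, hsq.2]
    refine ⟨s', e₀ * a, e₃ * d, hst, hp, h0, h3, ?_, ?_, ?_, ?_⟩
    · rw [mul_pow, esq e₀ he₀, hs.sq_left]; push_cast; ring
    · rw [mul_pow, esq e₃ he₃, hs.sq_right]; push_cast; ring
    · exact neg_of_mul_pos_left ha hs.re_left.le
    · exact pos_of_mul_pos_left hd hs.re_right.le
  refine ⟨m * (g ^ 2).re, c', ⟨?_, ?_⟩, fun a₀ d₀ s a d hi hr hs => (next a₀ d₀ s a d hi hr hs).2⟩
  -- That the new factor is nonzero comes from collision avoidance, which needs an actual chain to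
  -- be applied to.
  · obtain ⟨a₀, d₀, hi⟩ := exists_isInitialChain hV
    obtain ⟨s, a, d, hr, hs⟩ := h.2 a₀ d₀ hi
    exact mul_ne_zero h.1 (next a₀ d₀ s a d hi hr hs).1
  · intro a₀ d₀ hi
    obtain ⟨s, a, d, hr, hs⟩ := h.2 a₀ d₀ hi
    obtain ⟨-, s', a', d', hst, hs'⟩ := next a₀ d₀ s a d hi hr hs
    exact ⟨s', a', d', hr.step hst, hs'⟩

end Solution

theorem AE_notMem_task_limited (hV : 0 < V) (S : Scheduler) :
    AE V ∉ Task V S .limited (anonymousTeam 4 (by norm_num)) := by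
  rintro ⟨A, hA⟩
  obtain ⟨a₀, d₀, hi⟩ := exists_isInitialChain hV
  -- The invariant includes `Uniform`, a statement about all initial chains, since excluding a bad
  -- multiplier compares different chains.
  let Good : ℕ → State A → Prop := fun t s => Reach V A (chain V a₀ d₀) t s ∧
    ∃ m c a d, Uniform V A t m c ∧ IsSimilar V m c a₀ d₀ s a d
  have start : Good 0 (chain V a₀ d₀, fun _ => A.off) :=
    ⟨⟨aligned V A _, ⟨rfl, fun u => ⟨_, aligned_succ _ u⟩⟩, rfl⟩, 1, A.off, a₀, d₀, uniform_zero,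
      rfl, rfl, rfl, by simp, by simp, by linarith [hi.re_pos, hi.re_lt], hi.re_pos⟩
  have next : ∀ t s, Good t s → ∃ s', Step V A s s' ∧ Good (t + 1) s' := by
    rintro t s ⟨hr, m, c, a, d, hu, hs⟩
    obtain ⟨m', c', hu', h⟩ := hu.next hV hA
    obtain ⟨s', a', d', hst, hs'⟩ := h a₀ d₀ s a d hi hr hs
    exact ⟨s', hst, hr.step hst, m', c', a', d', hu', hs'⟩
  choose! F hF using next
  let π : ℕ → State A := fun t => Nat.rec (chain V a₀ d₀, fun _ => A.off) F t
  have hgood : ∀ t, Good t (π t) := by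
    intro t
    induction t with
    | zero => exact start
    | succ t ih => exact (hF t _ ih).2
  have hπ : IsRun V A (chain V a₀ d₀) π := ⟨rfl, fun t => (hF t _ (hgood t)).1⟩
  obtain ⟨-, -, T, -, hB, hC⟩ := hπ.admissible hA (hi.mem_initial hV)
  obtain ⟨-, m, c, a, d, hu, hs⟩ := hgood T
  exact hs.angle_ne hV hu.1 hi (hB.trans hC.symm)

end MobileRobots

theorem mainTheorem10 (V : ℝ) (hV : 0 < V) :
    (MobileRobots.MorePowerful V .fsynch .full .fsynch .limited ∧
      ∃ R : MobileRobots.Team 4,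
        MobileRobots.AE V ∈
          MobileRobots.Task V .fsynch .full R \ MobileRobots.Task V .fsynch .limited R) ∧
    (MobileRobots.MorePowerful V .ssynch .full .ssynch .limited ∧
      ∃ R : MobileRobots.Team 4,
        MobileRobots.AE V ∈
          MobileRobots.Task V .ssynch .full R \ MobileRobots.Task V .ssynch .limited R) := by
  have key : ∀ S : MobileRobots.Scheduler, MobileRobots.AE V ∈
      MobileRobots.Task V S .full (MobileRobots.anonymousTeam 4 (by norm_num)) \
        MobileRobots.Task V S .limited (MobileRobots.anonymousTeam 4 (by norm_num)) :=
    fun S => ⟨MobileRobots.AE_mem_task_full V S, MobileRobots.AE_notMem_task_limited hV S⟩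
  exact ⟨⟨⟨MobileRobots.notLessPowerful_full_limited V _, 4, _, _, key _⟩, _, key _⟩,
    ⟨⟨MobileRobots.notLessPowerful_full_limited V _, 4, _, _, key _⟩, _, key _⟩⟩
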